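/- Let $G=(V,E)$ be a finite directed graph with $n$ vertices (for instance a graph representing a partial order on $V$), and let $\lambda_F,\lambda_L,\lambda_{NI}\ge 0$ be fixed. For $y\in\mathbb{R}^V$ let $$\hat\beta^{FLNI}(y,\lambda_F,\lambda_L,\lambda_{NI})=\arg\min_{\beta\in\mathbb{R}^V}\ \tfrac12\|y-\beta\|_2^2+\lambda_F\sum_{(i,j)\in E}|\beta_i-\beta_j|+\lambda_L\|\beta\|_1+\lambda_{NI}\sum_{(i,j)\in E}(\beta_i-\beta_j)_+ ,$$ where $x_+=\max(x,0)$ (the minimiser exists and is unique), and let $\hat\beta^{FNI}(y,\lambda_F,\lambda_{NI})=\hat\beta^{FLNI}(y,\lambda_F,0,\lambda_{NI})$. A fused group of a vector $\beta\in\mathbb{R}^V$ is a connected component of the undirected graph on $V$ whose edges are the pairs $\{i,j\}$, $i\neq j$, such that $(i,j)\in E$ or $(j,i)\in E$, and $\beta_i=\beta_j$; it is non-zero if the constant value of $\beta$ on it is non-zero. Let $K^{FNI}(y)$ be the number of fused groups of $\hat\beta^{FNI}(y,\lambda_F,\lambda_{NI})$ and $K^{FLNI}(y)$ the number of non-zero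 fused groups of $\hat\beta^{FLNI}(y,\lambda_F,\lambda_L,\lambda_{NI})$. Let $Y=\mathring\beta+\varepsilon$ with $\mathring\beta\in\mathbb{R}^V$ fixed and $\varepsilon\sim\mathcal{N}(0,\sigma^2 I)$, $0<\sigma<\infty$, and for an estimator $\hat\beta$ put $$df(\hat\beta(Y))=\frac1{\sigma^2}\sum_{i\in V}\mathrm{Cov}[\hat\beta_i(Y),Y_i].$$ Then the components of $\hat\beta^{FNI}(Y)$ and $\hat\beta^{FLNI}(Y)$ are square integrable, $K^{FNI}(Y)$ and $K^{FLNI}(Y)$ are integrable, and $$\mathbb{E}[K^{FNI}(Y)]=df\big(\hat\beta^{FNI}(Y,\lambda_F,\lambda_{NI})\big),\qquad \mathbb{E}[K^{FLNI}(Y)]=df\big(\hat\beta^{FLNI}(Y,\lambda_F,\lambda_L,\lambda_{NI})\big).$$ -/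

import Mathlib

open MeasureTheory ProbabilityTheory

namespace FusedNearlyIsotonic

/-- The objective function of the fused lasso nearly-isotonic signal approximation on the directed
graph with vertex set `ι` and edge set `E`, with data `y` and penalisation parameters
`lF` (fusion), `lL` (lasso), `lNI` (nearly-isotonic):
`½ ‖y - β‖₂² + lF ∑_{(i,j) ∈ E} |βᵢ - βⱼ| + lL ‖β‖₁ + lNI ∑_{(i,j) ∈ E} (βᵢ - βⱼ)₊`. -/
noncomputable def objective {ι : Type*} [Fintype ι] (E : Finset (ι × ι)) (y : ι → ℝ)
    (lF lL lNI : ℝ) (b : ι → ℝ) : ℝ :=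
  1 / 2 * ∑ i, (y i - b i) ^ 2 + lF * ∑ e ∈ E, |b e.1 - b e.2| + lL * ∑ i, |b i|
    + lNI * ∑ e ∈ E, max (b e.1 - b e.2) 0

/-- `b` is a global minimiser of the objective function. -/
def IsMinimizer {ι : Type*} [Fintype ι] (E : Finset (ι × ι)) (y : ι → ℝ)
    (lF lL lNI : ℝ) (b : ι → ℝ) : Prop :=
  ∀ b' : ι → ℝ, objective E y lF lL lNI b ≤ objective E y lF lL lNI b'

/-- The fused lasso nearly-isotonic signal approximator: the minimiser of the objective function.
For non-negative penalisation parameters it exists and is unique, see `existsUnique_isMinimizer`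
and `flni_isMinimizer`. -/
noncomputable def flni {ι : Type*} [Fintype ι] (E : Finset (ι × ι)) (y : ι → ℝ)
    (lF lL lNI : ℝ) : ι → ℝ :=
  Classical.epsilon (IsMinimizer E y lF lL lNI)

/-- The fused nearly-isotonic approximator: the case of no lasso penalty. -/
noncomputable def fni {ι : Type*} [Fintype ι] (E : Finset (ι × ι)) (y : ι → ℝ)
    (lF lNI : ℝ) : ι → ℝ :=
  flni E y lF 0 lNI

/-- The undirected graph that keeps those edges of `E` along which `b` is constant. -/
def fusedGraph {ι : Type*} (E : Finset (ι × ι)) (b : ι → ℝ) : SimpleGraph ι :=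
  SimpleGraph.fromRel fun i j => (i, j) ∈ E ∧ b i = b j

/-- The fused groups of `b`: the maximal sets of vertices that are connected in the graph and on
which `b` is constant, i.e. the connected components of `fusedGraph E b`. -/
abbrev FusedGroup {ι : Type*} (E : Finset (ι × ι)) (b : ι → ℝ) : Type _ :=
  (fusedGraph E b).ConnectedComponent

/-- The number of fused groups of `b`. -/
noncomputable def numFusedGroups {ι : Type*} (E : Finset (ι × ι)) (b : ι → ℝ) : ℕ :=
  Nat.card (FusedGroup E b)

/-- The number of fused groups of `b` on which the (constant) value of `b` is non-zero. -/
noncomputable def numNonzeroFusedGroups {ι : Type*} (E : Finset (ι × ι)) (b : ι → ℝ) : ℕ :=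
  Nat.card {c : FusedGroup E b // ∀ i ∈ c.supp, b i ≠ 0}

/-- The degrees of freedom `σ⁻² ∑ᵢ Cov(b̂ᵢ(Y), Yᵢ)` of an estimator `bhat`, for the data vector `Y`
with noise level `σ`. -/
noncomputable def degreesOfFreedom {ι Ω : Type*} [Fintype ι] [MeasurableSpace Ω] (P : Measure Ω)
    (σ : ℝ) (Y : Ω → ι → ℝ) (bhat : (ι → ℝ) → ι → ℝ) : ℝ :=
  1 / σ ^ 2 * ∑ i, cov[fun ω => bhat (Y ω) i, fun ω => Y ω i; P]

lemma objective_continuous {ι : Type*} [Fintype ι] (E : Finset (ι × ι)) (y : ι → ℝ)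
    (lF lL lNI : ℝ) : Continuous (objective E y lF lL lNI) := by
  unfold objective
  fun_prop

lemma objective_midpoint_le {ι : Type*} [Fintype ι] (E : Finset (ι × ι)) (y : ι → ℝ)
    {lF lL lNI : ℝ} (hF : 0 ≤ lF) (hL : 0 ≤ lL) (hNI : 0 ≤ lNI) (a b : ι → ℝ) :
    objective E y lF lL lNI (fun i => (a i + b i) / 2) + 1 / 8 * ∑ i, (a i - b i) ^ 2 ≤
      (objective E y lF lL lNI a + objective E y lF lL lNI b) / 2 := by
  unfold objective
  have h1 : 1 / 2 * ∑ i, (y i - (a i + b i) / 2) ^ 2 + 1 / 8 * ∑ i, (a i - b i) ^ 2 =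
      (1 / 2 * ∑ i, (y i - a i) ^ 2 + 1 / 2 * ∑ i, (y i - b i) ^ 2) / 2 := by
    simp only [Finset.mul_sum, ← Finset.sum_add_distrib, Finset.sum_div]
    exact Finset.sum_congr rfl fun i _ => by ring
  have h2 : ∑ e ∈ E, |(a e.1 + b e.1) / 2 - (a e.2 + b e.2) / 2| ≤
      (∑ e ∈ E, |a e.1 - a e.2| + ∑ e ∈ E, |b e.1 - b e.2|) / 2 := by
    simp only [← Finset.sum_add_distrib, Finset.sum_div]
    refine Finset.sum_le_sum fun e _ => ?_
    rw [abs_le]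
    constructor <;>
      linarith [le_abs_self (a e.1 - a e.2), neg_abs_le (a e.1 - a e.2),
        le_abs_self (b e.1 - b e.2), neg_abs_le (b e.1 - b e.2)]
  have h3 : ∑ i, |(a i + b i) / 2| ≤ (∑ i, |a i| + ∑ i, |b i|) / 2 := by
    simp only [← Finset.sum_add_distrib, Finset.sum_div]
    refine Finset.sum_le_sum fun i _ => ?_
    rw [abs_le]
    constructor <;>
      linarith [le_abs_self (a i), neg_abs_le (a i), le_abs_self (b i), neg_abs_le (b i)]
  have h4 : ∑ e ∈ E, max ((a e.1 + b e.1) / 2 - (a e.2 + b e.2) / 2) 0 ≤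
      (∑ e ∈ E, max (a e.1 - a e.2) 0 + ∑ e ∈ E, max (b e.1 - b e.2) 0) / 2 := by
    simp only [← Finset.sum_add_distrib, Finset.sum_div]
    refine Finset.sum_le_sum fun e _ => max_le ?_ ?_ <;>
      linarith [le_max_left (a e.1 - a e.2) 0, le_max_right (a e.1 - a e.2) 0,
        le_max_left (b e.1 - b e.2) 0, le_max_right (b e.1 - b e.2) 0]
  have h2' := mul_le_mul_of_nonneg_left h2 hF
  have h3' := mul_le_mul_of_nonneg_left h3 hL
  have h4' := mul_le_mul_of_nonneg_left h4 hNI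
  linarith

lemma existsUnique_isMinimizer {ι : Type*} [Fintype ι] (E : Finset (ι × ι)) (y : ι → ℝ)
    {lF lL lNI : ℝ} (hF : 0 ≤ lF) (hL : 0 ≤ lL) (hNI : 0 ≤ lNI) :
    ∃! b, IsMinimizer E y lF lL lNI b := by
  have hex : ∃ b, IsMinimizer E y lF lL lNI b := by
    set c := objective E y lF lL lNI y with hc
    refine (objective_continuous E y lF lL lNI).exists_forall_le' y ?_
    have hev : ∀ᶠ b in Filter.cocompact (ι → ℝ), b ∉ Metric.closedBall y (|2 * c| + 1) :=
      (isCompact_closedBall y _).compl_mem_cocompact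
    filter_upwards [hev] with b hb
    have hR : 0 ≤ |2 * c| + 1 := by positivity
    rw [Metric.mem_closedBall, dist_pi_le_iff hR] at hb
    push Not at hb
    obtain ⟨i, hi⟩ := hb
    rw [Real.dist_eq] at hi
    have h1 : (y i - b i) ^ 2 ≤ ∑ j, (y j - b j) ^ 2 :=
      Finset.single_le_sum (f := fun j => (y j - b j) ^ 2) (fun j _ => sq_nonneg _)
        (Finset.mem_univ i)
    have h2 : 2 * c ≤ (y i - b i) ^ 2 := by
      rw [← sq_abs, abs_sub_comm]
      nlinarith [le_abs_self (2 * c), abs_nonneg (2 * c)]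
    have h3 : 0 ≤ lF * ∑ e ∈ E, |b e.1 - b e.2| :=
      mul_nonneg hF (Finset.sum_nonneg fun _ _ => abs_nonneg _)
    have h4 : 0 ≤ lL * ∑ i, |b i| :=
      mul_nonneg hL (Finset.sum_nonneg fun _ _ => abs_nonneg _)
    have h5 : 0 ≤ lNI * ∑ e ∈ E, max (b e.1 - b e.2) 0 :=
      mul_nonneg hNI (Finset.sum_nonneg fun _ _ => le_max_right _ _)
    rw [← hc]
    unfold objective
    linarith
  obtain ⟨b, hb⟩ := hex
  refine ⟨b, hb, fun a ha => ?_⟩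
  have h := objective_midpoint_le E y hF hL hNI a b
  have h1 := hb (fun i => (a i + b i) / 2)
  have h2 := ha b
  have h0 : ∑ i, (a i - b i) ^ 2 = 0 :=
    le_antisymm (by linarith) (Finset.sum_nonneg fun i _ => sq_nonneg _)
  funext i
  have h3 := (Finset.sum_eq_zero_iff_of_nonneg fun i _ => sq_nonneg _).1 h0 i (Finset.mem_univ i)
  exact sub_eq_zero.1 (pow_eq_zero_iff two_ne_zero |>.1 h3)

lemma flni_isMinimizer {ι : Type*} [Fintype ι] (E : Finset (ι × ι)) (y : ι → ℝ)
    {lF lL lNI : ℝ} (hF : 0 ≤ lF) (hL : 0 ≤ lL) (hNI : 0 ≤ lNI) :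
    IsMinimizer E y lF lL lNI (flni E y lF lL lNI) :=
  Classical.epsilon_spec (existsUnique_isMinimizer E y hF hL hNI).exists

end FusedNearlyIsotonic

open FusedNearlyIsotonic

/-! Stein's identity turns the degrees of freedom into an expected divergence: for Lipschitz `g`,
Cov(g(Y), Yᵢ) = σ² E[∂ᵢg(Y)] (`covariance_eq_mul_integral_lineDeriv`). The estimator is Lipschitz
because its objective is strongly convex (`flni_lipschitz`). It remains to see that its divergence
is almost everywhere the number of fused groups.

Stationarity in the direction of the indicator of a group says that the size of the group times its
value is the sum of `y` over the group minus a term depending only on the signs of `b` and of its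
differences (`IsMinimizer.card_mul_eq`). A zero group under a lasso penalty is exempt, but its value
stays zero while the signs do. So on each set of data with a given sign pattern the estimator is
affine, with linear part the averaging over groups (`sub_eq_groupAverage_sub`). There are finitely
many patterns, and almost every point of each set is a density point, where the derivative, which
exists almost everywhere by Rademacher's theorem, must be that linear part. A group of size m
contributes m · (1/m) = 1 to its trace (`sum_groupAverage_single`). No local constancy of the groups
is needed.

The proposition `z` treats both claims at once: it says whether groups with value zero are
discarded. -/

namespace FusedNearlyIsotonic

open Filter Topology
open scoped NNReal

/-! ### Stein's identity for Lipschitz functions -/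

lemma hasDerivAt_gaussianPDFReal_zero {v : ℝ≥0} (hv : v ≠ 0) (x : ℝ) :
    HasDerivAt (gaussianPDFReal 0 v) (-(x / v) * gaussianPDFReal 0 v x) x := by
  have hv' : (v : ℝ) ≠ 0 := by exact_mod_cast hv
  have h1 : HasDerivAt (fun x : ℝ => -(x - 0) ^ 2 / (2 * (v : ℝ))) (-(x / v)) x := by
    have := ((((hasDerivAt_id x).sub_const 0).pow 2).neg).div_const (2 * (v : ℝ))
    refine this.congr_deriv ?_
    simp
    field_simp
  refine (h1.exp.const_mul (√(2 * Real.pi * v))⁻¹).congr_deriv ?_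
  rw [gaussianPDFReal]
  ring

lemma contDiff_gaussianPDFReal (m : ℝ) (v : ℝ≥0) : ContDiff ℝ 1 (gaussianPDFReal m v) := by
  rw [gaussianPDFReal_def]
  fun_prop

lemma LipschitzWith.abs_le_add_mul_abs {C : ℝ≥0} {h : ℝ → ℝ} (hh : LipschitzWith C h) (x : ℝ) :
    |h x| ≤ |h 0| + C * |x| := by
  have h1 := hh.dist_le_mul x 0
  rw [Real.dist_eq, Real.dist_eq, sub_zero] at h1
  linarith [abs_sub_abs_le_abs_sub (h x) (h 0)]

/-- Linear growth loses against Gaussian decay; this removes the boundary terms when integrating by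
parts. -/
lemma tendsto_lipschitz_mul_gaussianPDFReal {v : ℝ≥0} (hv : v ≠ 0) {C : ℝ≥0} {h : ℝ → ℝ}
    (hh : LipschitzWith C h) :
    Tendsto (fun x => h x * gaussianPDFReal 0 v x) (cocompact ℝ) (𝓝 0) := by
  have ha : 0 < (2 * (v : ℝ))⁻¹ := by positivity
  have h0 := tendsto_rpow_abs_mul_exp_neg_mul_sq_cocompact ha 0
  have h1 := tendsto_rpow_abs_mul_exp_neg_mul_sq_cocompact ha 1
  have h2 := (((h0.const_mul |h 0|).add (h1.const_mul (C : ℝ))).const_mul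
    (√(2 * Real.pi * v))⁻¹)
  simp only [mul_zero, add_zero] at h2
  refine squeeze_zero_norm (fun x => ?_) h2
  rw [norm_mul, Real.norm_eq_abs, Real.norm_of_nonneg (gaussianPDFReal_nonneg 0 v x)]
  calc |h x| * gaussianPDFReal 0 v x
      ≤ (|h 0| + C * |x|) * gaussianPDFReal 0 v x :=
        mul_le_mul_of_nonneg_right (hh.abs_le_add_mul_abs x) (gaussianPDFReal_nonneg 0 v x)
    _ = _ := by
        rw [gaussianPDFReal, Real.rpow_zero, Real.rpow_one,
          show -(x - 0) ^ 2 / (2 * (v : ℝ)) = -(2 * (v : ℝ))⁻¹ * x ^ 2 by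
            rw [sub_zero]; field_simp]
        ring

lemma LipschitzWith.memLp_comp {E F Ω : Type*} [NormedAddCommGroup E] [NormedAddCommGroup F]
    [MeasurableSpace Ω] {μ : Measure Ω} [IsFiniteMeasure μ] {p : ENNReal} {C : ℝ≥0} {g : E → F}
    (hg : LipschitzWith C g) {X : Ω → E} (hX : MemLp X p μ) : MemLp (fun ω => g (X ω)) p μ := by
  have h := (show LipschitzWith C fun x => g x - g 0 from fun x y => by
    simpa using hg x y).comp_memLp (by simp) hX
  refine (h.add (memLp_const (g 0))).ae_eq (ae_of_all _ fun ω => ?_)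
  simp

lemma memLp_two_id_gaussianReal (m : ℝ) (v : ℝ≥0) :
    MemLp (fun x : ℝ => x) 2 (gaussianReal m v) :=
  memLp_id_gaussianReal' 2 (by simp)

lemma integrable_gaussianReal_iff {m : ℝ} {v : ℝ≥0} (hv : v ≠ 0) {f : ℝ → ℝ} :
    Integrable f (gaussianReal m v) ↔ Integrable fun x => gaussianPDFReal m v x * f x := by
  rw [gaussianReal_of_var_ne_zero _ hv, integrable_withDensity_iff_integrable_smul'
    (measurable_gaussianPDF _ _) (ae_of_all _ fun _ => gaussianPDF_lt_top)]
  simp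

/-- Stein's identity for a Lipschitz function of a centred real Gaussian variable. -/
lemma integral_mul_lipschitz_gaussianReal {v : ℝ≥0} (hv : v ≠ 0) {C : ℝ≥0} {h : ℝ → ℝ}
    (hh : LipschitzWith C h) :
    ∫ x, x * h x ∂(gaussianReal 0 v) = v * ∫ x, deriv h x ∂(gaussianReal 0 v) := by
  have hv' : (v : ℝ) ≠ 0 := by exact_mod_cast hv
  have hI1 : Integrable (fun x => x * h x) (gaussianReal 0 v) :=
    (memLp_two_id_gaussianReal 0 v).integrable_mul
      (hh.memLp_comp (memLp_two_id_gaussianReal 0 v))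
  have hI2 : Integrable (deriv h) (gaussianReal 0 v) :=
    Integrable.of_bound (measurable_deriv h).aestronglyMeasurable C
      (ae_of_all _ fun x => norm_deriv_le_of_lipschitz hh)
  -- The density satisfies p' = -(x/v) p, so a factor x in the integral is, up to -v, a derivative
  -- of the density.
  have hp : deriv (gaussianPDFReal 0 v) = fun x => -(x / v) * gaussianPDFReal 0 v x :=
    funext fun x => (hasDerivAt_gaussianPDFReal_zero hv x).deriv
  -- A Lipschitz function is absolutely continuous on bounded intervals, so integration by parts
  -- holds although `h` need only be differentiable almost everywhere.
  have hparts : ∀ R : ℝ, ∫ x in (-R)..R, h x * deriv (gaussianPDFReal 0 v) x =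
      h R * gaussianPDFReal 0 v R - h (-R) * gaussianPDFReal 0 v (-R) -
        ∫ x in (-R)..R, deriv h x * gaussianPDFReal 0 v x := fun R =>
    AbsolutelyContinuousOnInterval.integral_mul_deriv_eq_deriv_mul
      (hh.lipschitzOnWith.absolutelyContinuousOnInterval)
      (contDiff_gaussianPDFReal 0 v).contDiffOn.absolutelyContinuousOnInterval
  have hJ1 : Integrable fun x => h x * deriv (gaussianPDFReal 0 v) x := by
    have := ((integrable_gaussianReal_iff hv).1 hI1).const_mul (-(v : ℝ)⁻¹)
    refine this.congr (ae_of_all _ fun x => ?_)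
    simp only [hp]
    field_simp
  have hJ2 : Integrable fun x => deriv h x * gaussianPDFReal 0 v x := by
    simpa only [mul_comm] using (integrable_gaussianReal_iff hv).1 hI2
  have hb := tendsto_lipschitz_mul_gaussianPDFReal hv hh
  have t1 := intervalIntegral_tendsto_integral hJ1 tendsto_neg_atTop_atBot tendsto_id
  have t2 := ((hb.mono_left atTop_le_cocompact).sub
    ((hb.mono_left atBot_le_cocompact).comp tendsto_neg_atTop_atBot)).sub
    (intervalIntegral_tendsto_integral hJ2 tendsto_neg_atTop_atBot tendsto_id)
  have key := tendsto_nhds_unique (t1.congr hparts) t2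
  rw [integral_gaussianReal_eq_integral_smul hv, integral_gaussianReal_eq_integral_smul hv]
  simp only [smul_eq_mul]
  have e1 : ∫ x, gaussianPDFReal 0 v x * (x * h x) =
      -(v : ℝ) * ∫ x, h x * deriv (gaussianPDFReal 0 v) x := by
    rw [← integral_const_mul]
    refine integral_congr_ae (ae_of_all _ fun x => ?_)
    simp only [hp]
    field_simp
  rw [e1, key]
  simp only [mul_comm (deriv h _)]
  ring

/-! ### Gaussian vectors: coordinatewise Stein identity and absolute continuity -/

section Pi

variable {ι : Type*} [Fintype ι]

/-- Resampling one coordinate of a product probability measure preserves the measure. -/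
lemma measurePreserving_update [DecidableEq ι] (μ : ι → Measure ℝ)
    [∀ i, IsProbabilityMeasure (μ i)] (i : ι) :
    MeasurePreserving (fun p : (ι → ℝ) × ℝ => Function.update p.1 i p.2)
      ((Measure.pi μ).prod (μ i)) (Measure.pi μ) := by
  have hm : Measurable fun p : (ι → ℝ) × ℝ => Function.update p.1 i p.2 := by
    refine measurable_pi_lambda _ fun j => ?_
    by_cases hj : j = i
    · subst hj
      simpa using measurable_snd
    · simp only [Function.update_of_ne hj]
      exact (measurable_pi_apply j).comp measurable_fst
  refine ⟨hm, (Measure.pi_eq fun s hs => ?_).symm⟩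
  rw [Measure.map_apply hm (MeasurableSet.univ_pi hs)]
  -- The old `i`-th coordinate is overwritten, hence unconstrained; the new one carries the
  -- constraint `s i`.
  have hpre : (fun p : (ι → ℝ) × ℝ => Function.update p.1 i p.2) ⁻¹' Set.univ.pi s =
      (Set.univ.pi (Function.update s i Set.univ)) ×ˢ s i := by
    ext ⟨x, t⟩
    simp only [Set.mem_preimage, Set.mem_pi, Set.mem_univ, true_implies, Set.mem_prod]
    constructor
    · refine fun h => ⟨fun j => ?_, by simpa using h i⟩
      by_cases hj : j = i
      · subst hj; simp
      · simpa [hj] using h j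
    · rintro ⟨h, ht⟩ j
      by_cases hj : j = i
      · subst hj; simpa using ht
      · simpa [hj] using h j
  rw [hpre, Measure.prod_prod, Measure.pi_pi, ← Finset.mul_prod_erase _ _ (Finset.mem_univ i),
    ← Finset.mul_prod_erase _ (fun j => μ j (s j)) (Finset.mem_univ i)]
  have : ∏ j ∈ Finset.univ.erase i, μ j (Function.update s i Set.univ j) =
      ∏ j ∈ Finset.univ.erase i, μ j (s j) :=
    Finset.prod_congr rfl fun j hj => by
      rw [Function.update_of_ne (Finset.ne_of_mem_erase hj)]
  rw [this]
  simp [mul_comm]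

lemma deriv_update_eq_lineDeriv {ι : Type*} [DecidableEq ι] (g : (ι → ℝ) → ℝ)
    (x : ι → ℝ) (i : ι) (t : ℝ) :
    deriv (fun s => g (Function.update x i s)) t =
      lineDeriv ℝ g (Function.update x i t) (Pi.single i 1) := by
  have h : ∀ s : ℝ, Function.update x i t + s • (Pi.single i 1 : ι → ℝ) =
      Function.update x i (t + s) := fun s => by
    ext j
    by_cases hj : j = i
    · subst hj; simp
    · simp [hj]
  rw [lineDeriv]
  simp only [h]
  rw [deriv_comp_const_add (f := fun s => g (Function.update x i s)), add_zero]

lemma memLp_id_pi_gaussianReal (v : ℝ≥0) :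
    MemLp (fun x : ι → ℝ => x) 2 (Measure.pi fun _ : ι => gaussianReal 0 v) :=
  memLp_pi_iff.2 fun i =>
    (memLp_two_id_gaussianReal 0 v).comp_measurePreserving
      (measurePreserving_eval (fun _ : ι => gaussianReal 0 v) i)

/-- Stein's identity for a Lipschitz function of a centred Gaussian vector with independent
components of the same variance. -/
lemma integral_mul_lipschitz_pi_gaussianReal [DecidableEq ι] {v : ℝ≥0} (hv : v ≠ 0) {C : ℝ≥0}
    {g : (ι → ℝ) → ℝ} (hg : LipschitzWith C g) (i : ι) :
    ∫ x, x i * g x ∂(Measure.pi fun _ : ι => gaussianReal 0 v) =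
      v * ∫ x, lineDeriv ℝ g x (Pi.single i 1) ∂(Measure.pi fun _ : ι => gaussianReal 0 v) := by
  set μ := Measure.pi fun _ : ι => gaussianReal 0 v
  have hmp := measurePreserving_update (fun _ : ι => gaussianReal 0 v) i
  have hI1 : Integrable (fun x : ι → ℝ => x i * g x) μ :=
    ((memLp_id_pi_gaussianReal v).eval i).integrable_mul
      (hg.memLp_comp (memLp_id_pi_gaussianReal v))
  have hI2 : Integrable (fun x : ι → ℝ => lineDeriv ℝ g x (Pi.single i 1)) μ :=
    Integrable.of_bound (measurable_lineDeriv hg.continuous).aestronglyMeasurable _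
      (ae_of_all _ fun x => norm_lineDeriv_le_of_lipschitz ℝ hg)
  -- Resampling coordinate `i` creates an inner integral along a coordinate line, where the
  -- one-dimensional identity applies, without splitting the product space.
  have hresample : ∀ {F : (ι → ℝ) → ℝ}, Integrable F μ →
      ∫ x, F x ∂μ = ∫ x, ∫ t, F (Function.update x i t) ∂(gaussianReal 0 v) ∂μ := by
    intro F hF
    refine Eq.trans ?_ (integral_prod _ (hmp.integrable_comp_of_integrable hF))
    conv_lhs => rw [show μ = _ from hmp.map_eq.symm]
    refine integral_map hmp.measurable.aemeasurable ?_
    rw [hmp.map_eq]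
    exact hF.aestronglyMeasurable
  rw [hresample hI1, hresample hI2, ← integral_const_mul]
  refine integral_congr_ae (ae_of_all _ fun x => ?_)
  have hx : LipschitzWith C fun t => g (Function.update x i t) := by
    refine LipschitzWith.of_dist_le_mul fun s t => (hg.dist_le_mul _ _).trans ?_
    refine mul_le_mul_of_nonneg_left ((dist_pi_le_iff dist_nonneg).2 fun j => ?_) C.coe_nonneg
    by_cases hj : j = i
    · subst hj; simp
    · simp [hj]
  simp only [Function.update_self, ← deriv_update_eq_lineDeriv]
  exact integral_mul_lipschitz_gaussianReal hv hx

/-- Carries Lebesgue-almost-everywhere statements over to the noise. The product of the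
one-dimensional densities is a density, as is checked on boxes. -/
lemma pi_gaussianReal_absolutelyContinuous {v : ℝ≥0} (hv : v ≠ 0) :
    (Measure.pi fun _ : ι => gaussianReal 0 v) ≪ (volume : Measure (ι → ℝ)) := by
  have h : (Measure.pi fun _ : ι => gaussianReal 0 v) = (volume : Measure (ι → ℝ)).withDensity
      fun x => ENNReal.ofReal (∏ i, gaussianPDFReal 0 v (x i)) := by
    refine Measure.pi_eq fun s hs => ?_
    have hint : Integrable fun x : ι → ℝ => ∏ i, (s i).indicator (gaussianPDFReal 0 v) (x i) :=
      Integrable.fintype_prod fun i => (integrable_gaussianPDFReal 0 v).indicator (hs i)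
    have hind : ∀ x : ι → ℝ, (Set.univ.pi s).indicator
        (fun x => ENNReal.ofReal (∏ i, gaussianPDFReal 0 v (x i))) x =
        ENNReal.ofReal (∏ i, (s i).indicator (gaussianPDFReal 0 v) (x i)) := fun x => by
      by_cases hx : x ∈ Set.univ.pi s
      · rw [Set.indicator_of_mem hx]
        congr 1
        exact Finset.prod_congr rfl fun i _ => (Set.indicator_of_mem (hx i trivial) _).symm
      · rw [Set.indicator_of_notMem hx]
        simp only [Set.mem_pi, Set.mem_univ, true_implies, not_forall] at hx
        obtain ⟨i, hi⟩ := hx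
        rw [Finset.prod_eq_zero (Finset.mem_univ i) (Set.indicator_of_notMem hi _),
          ENNReal.ofReal_zero]
    have hnn : ∀ i x, 0 ≤ (s i).indicator (gaussianPDFReal 0 v) x := fun i x =>
      Set.indicator_nonneg (fun y _ => gaussianPDFReal_nonneg 0 v y) x
    rw [withDensity_apply _ (MeasurableSet.univ_pi hs), ← lintegral_indicator
      (MeasurableSet.univ_pi hs)]
    simp only [hind]
    rw [← ofReal_integral_eq_lintegral_ofReal hint
      (ae_of_all _ fun x => Finset.prod_nonneg fun i _ => hnn i (x i)),
      integral_fintype_prod_volume_eq_prod (fun i => (s i).indicator (gaussianPDFReal 0 v)),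
      ENNReal.ofReal_prod_of_nonneg fun i _ => integral_nonneg (hnn i)]
    refine Finset.prod_congr rfl fun i _ => ?_
    rw [integral_indicator (hs i), gaussianReal_apply_eq_integral 0 hv]
  rw [h]
  exact withDensity_absolutelyContinuous _ _

end Pi

section Estimator

variable {ι : Type*} [Fintype ι]

/-! ### Lipschitz continuity of the approximator -/

/-- Quadratic growth from strong convexity: the minimiser does no worse than the midpoint, and
clearing the factor 1/2 turns 1/8 into 1/4. -/
lemma IsMinimizer.add_sq_le {E : Finset (ι × ι)} {y : ι → ℝ} {lF lL lNI : ℝ} (hF : 0 ≤ lF)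
    (hL : 0 ≤ lL) (hNI : 0 ≤ lNI) {b : ι → ℝ} (hb : IsMinimizer E y lF lL lNI b) (a : ι → ℝ) :
    objective E y lF lL lNI b + 1 / 4 * ∑ i, (a i - b i) ^ 2 ≤ objective E y lF lL lNI a := by
  have h1 := objective_midpoint_le E y hF hL hNI a b
  have h2 := hb fun i => (a i + b i) / 2
  linarith

/-- The penalties do not involve the data and cancel, as do the squares; only the cross terms
survive. -/
lemma objective_sub_objective (E : Finset (ι × ι)) (y y' : ι → ℝ) (lF lL lNI : ℝ) (b b' : ι → ℝ) :
    objective E y lF lL lNI b' - objective E y lF lL lNI b +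
      (objective E y' lF lL lNI b - objective E y' lF lL lNI b') =
      ∑ i, (y i - y' i) * (b i - b' i) := by
  have h : 1 / 2 * ∑ i, (y i - b' i) ^ 2 - 1 / 2 * ∑ i, (y i - b i) ^ 2 +
      (1 / 2 * ∑ i, (y' i - b i) ^ 2 - 1 / 2 * ∑ i, (y' i - b' i) ^ 2) =
      ∑ i, (y i - y' i) * (b i - b' i) := by
    simp only [Finset.mul_sum, ← Finset.sum_add_distrib, ← Finset.sum_sub_distrib]
    exact Finset.sum_congr rfl fun i _ => by ring
  unfold objective
  linarith

/-- Adding the two quadratic growth inequalities bounds ‖b - b'‖₂² by 2⟨y - y', b - b'⟩. The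
constant is not sharp: it absorbs the passage to the sup distance, and any constant serves. -/
lemma flni_lipschitz (E : Finset (ι × ι)) {lF lL lNI : ℝ} (hF : 0 ≤ lF)
    (hL : 0 ≤ lL) (hNI : 0 ≤ lNI) :
    LipschitzWith (2 * Fintype.card ι : ℝ≥0) fun y => flni E y lF lL lNI := by
  refine LipschitzWith.of_dist_le_mul fun y y' => ?_
  set b := flni E y lF lL lNI
  set b' := flni E y' lF lL lNI
  have h1 := (flni_isMinimizer E y hF hL hNI).add_sq_le hF hL hNI b'
  have h2 := (flni_isMinimizer E y' hF hL hNI).add_sq_le hF hL hNI b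
  have h3 := objective_sub_objective E y y' lF lL lNI b b'
  have hsymm : ∑ i, (b' i - b i) ^ 2 = ∑ i, (b i - b' i) ^ 2 :=
    Finset.sum_congr rfl fun i _ => by ring
  have hsq : ∑ i, (b i - b' i) ^ 2 ≤ 2 * ∑ i, (y i - y' i) * (b i - b' i) := by
    simp only [b, b'] at *
    linarith
  have hle : ∑ i, (y i - y' i) * (b i - b' i) ≤ Fintype.card ι * (dist y y' * dist b b') := by
    calc ∑ i, (y i - y' i) * (b i - b' i) ≤ ∑ _i : ι, dist y y' * dist b b' := by
          refine Finset.sum_le_sum fun i _ => (le_abs_self _).trans ?_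
          rw [abs_mul]
          exact mul_le_mul (dist_le_pi_dist y y' i) (dist_le_pi_dist b b' i) (abs_nonneg _)
            dist_nonneg
      _ = _ := by simp
  have hK : 0 ≤ 2 * (Fintype.card ι : ℝ) * dist y y' := by positivity
  push_cast
  refine (dist_pi_le_iff hK).2 fun i => ?_
  by_contra! hi
  -- At a coordinate attaining the sup distance, dist(b,b')² is one term of the sum of squares, so
  -- one factor dist(b,b'), positive by `hi`, can be divided out.
  obtain ⟨j, -, hj⟩ := Finset.exists_max_image Finset.univ (fun j => dist (b j) (b' j))
    ⟨i, Finset.mem_univ i⟩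
  have hd : dist b b' = dist (b j) (b' j) :=
    le_antisymm ((dist_pi_le_iff dist_nonneg).2 fun k => hj k (Finset.mem_univ k))
      (dist_le_pi_dist b b' j)
  have hij := hj i (Finset.mem_univ i)
  have hj1 : dist b b' ^ 2 ≤ ∑ i, (b i - b' i) ^ 2 := by
    rw [hd, Real.dist_eq, sq_abs]
    exact Finset.single_le_sum (f := fun j => (b j - b' j) ^ 2) (fun _ _ => sq_nonneg _)
      (Finset.mem_univ j)
  nlinarith [dist_nonneg (x := b) (y := b')]

/-! ### First-order conditions along fused groups -/

/-- The hypothesis avoids the kink: at `x = 0` the function is constant, and sign 0 = 0 keeps the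
formula uniform. -/
lemma hasDerivAt_abs_add_mul {x u : ℝ} (h : x = 0 → u = 0) :
    HasDerivAt (fun t : ℝ => |x + t * u|) (SignType.sign x * u) 0 := by
  by_cases hx : x = 0
  · simpa [h hx] using hasDerivAt_const (0 : ℝ) |x|
  · have h1 : HasDerivAt (fun t : ℝ => x + t * u) u 0 := by
      simpa using ((hasDerivAt_id (0 : ℝ)).mul_const u).const_add x
    have h2 : HasDerivAt (fun z : ℝ => |z|) (SignType.sign x : ℝ) (x + 0 * u) := by
      simpa using hasDerivAt_abs hx
    exact h2.comp (0 : ℝ) h1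

lemma max_zero_eq_half (x : ℝ) : max x 0 = (x + |x|) / 2 := by
  rcases le_total 0 x with h | h
  · rw [max_eq_left h, abs_of_nonneg h]; ring
  · rw [max_eq_right h, abs_of_nonpos h]; ring

lemma hasDerivAt_max_add_mul {x u : ℝ} (h : x = 0 → u = 0) :
    HasDerivAt (fun t : ℝ => max (x + t * u) 0) ((u + SignType.sign x * u) / 2) 0 := by
  simp only [max_zero_eq_half]
  refine HasDerivAt.div_const (HasDerivAt.add ?_ (hasDerivAt_abs_add_mul h)) 2
  simpa using ((hasDerivAt_id (0 : ℝ)).mul_const u).const_add x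

/-- The directional derivative of the penalty at `b` in direction `d`, for a direction `d` along
which the penalty is differentiable. It depends on `b` only through signs. -/
noncomputable def penaltySlope (E : Finset (ι × ι)) (lF lL lNI : ℝ) (b d : ι → ℝ) : ℝ :=
  lF * ∑ e ∈ E, (SignType.sign (b e.1 - b e.2) : ℝ) * (d e.1 - d e.2) +
    lL * ∑ i, (SignType.sign (b i) : ℝ) * d i +
    lNI * ∑ e ∈ E, ((d e.1 - d e.2) + (SignType.sign (b e.1 - b e.2) : ℝ) * (d e.1 - d e.2)) / 2

/-- The stationarity condition in a direction which keeps the fusions (and zeros) of `b`. -/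
lemma IsMinimizer.sum_sub_mul_eq {E : Finset (ι × ι)} {y : ι → ℝ} {lF lL lNI : ℝ} {b : ι → ℝ}
    (hb : IsMinimizer E y lF lL lNI b) {d : ι → ℝ}
    (hE : ∀ e ∈ E, b e.1 = b e.2 → d e.1 = d e.2) (hZ : lL = 0 ∨ ∀ i, b i = 0 → d i = 0) :
    ∑ i, (y i - b i) * d i = penaltySlope E lF lL lNI b d := by
  have hE' : ∀ e ∈ E, b e.1 - b e.2 = 0 → d e.1 - d e.2 = 0 := fun e he h =>
    sub_eq_zero.2 (hE e he (sub_eq_zero.1 h))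
  have h1 : HasDerivAt (fun t : ℝ => 1 / 2 * ∑ i, (y i - (b i + t * d i)) ^ 2)
      (1 / 2 * ∑ i, -(2 * ((y i - b i) * d i))) 0 := by
    refine (HasDerivAt.fun_sum fun i _ => ?_).const_mul _
    have := ((((hasDerivAt_id (0 : ℝ)).mul_const (d i)).const_add (b i)).const_sub (y i)).pow 2
    refine this.congr_deriv ?_
    simp
    ring
  have h2 : HasDerivAt (fun t : ℝ => lF * ∑ e ∈ E, |b e.1 + t * d e.1 - (b e.2 + t * d e.2)|)
      (lF * ∑ e ∈ E, (SignType.sign (b e.1 - b e.2) : ℝ) * (d e.1 - d e.2)) 0 := by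
    refine (HasDerivAt.fun_sum fun e he => ?_).const_mul _
    simpa only [mul_sub, add_sub_add_comm] using hasDerivAt_abs_add_mul (hE' e he)
  have h3 : HasDerivAt (fun t : ℝ => lL * ∑ i, |b i + t * d i|)
      (lL * ∑ i, (SignType.sign (b i) : ℝ) * d i) 0 := by
    rcases hZ with h | h
    · simpa [h] using hasDerivAt_const (0 : ℝ) (0 : ℝ)
    · exact (HasDerivAt.fun_sum fun i _ => hasDerivAt_abs_add_mul (h i)).const_mul _
  have h4 : HasDerivAt
      (fun t : ℝ => lNI * ∑ e ∈ E, max (b e.1 + t * d e.1 - (b e.2 + t * d e.2)) 0)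
      (lNI * ∑ e ∈ E, ((d e.1 - d e.2) +
        (SignType.sign (b e.1 - b e.2) : ℝ) * (d e.1 - d e.2)) / 2) 0 := by
    refine (HasDerivAt.fun_sum fun e he => ?_).const_mul _
    simpa only [mul_sub, add_sub_add_comm] using hasDerivAt_max_add_mul (hE' e he)
  have hd : HasDerivAt (fun t : ℝ => objective E y lF lL lNI fun i => b i + t * d i) _ 0 :=
    ((h1.add h2).add h3).add h4
  have hmin : IsLocalMin (fun t : ℝ => objective E y lF lL lNI fun i => b i + t * d i) 0 :=
    Filter.Eventually.of_forall fun t => by simpa using hb fun i => b i + t * d i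
  have h0 := hmin.hasDerivAt_eq_zero hd
  rw [Finset.sum_neg_distrib, ← Finset.mul_sum] at h0
  unfold penaltySlope
  linarith

/-! ### The approximator is affine on each sign pattern -/

/-- The signs of the differences of the entries of `b`, and of its entries. -/
noncomputable def signPattern {ι : Type*} (b : ι → ℝ) : (ι × ι → SignType) × (ι → SignType) :=
  (fun e => SignType.sign (b e.1 - b e.2), fun i => SignType.sign (b i))

lemma eq_iff_of_signPattern_eq {ι : Type*} {b b' : ι → ℝ}
    (h : signPattern b = signPattern b') (i j : ι) :
    b i = b j ↔ b' i = b' j := by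
  have := congrFun (congrArg Prod.fst h) (i, j)
  simp only [signPattern] at this
  rw [← sub_eq_zero, ← sign_eq_zero_iff, this, sign_eq_zero_iff, sub_eq_zero]

lemma eq_zero_iff_of_signPattern_eq {ι : Type*} {b b' : ι → ℝ}
    (h : signPattern b = signPattern b') (i : ι) :
    b i = 0 ↔ b' i = 0 := by
  have := congrFun (congrArg Prod.snd h) i
  simp only [signPattern] at this
  rw [← sign_eq_zero_iff, this, sign_eq_zero_iff]

lemma fusedGraph_eq_of_signPattern_eq {ι : Type*} (E : Finset (ι × ι)) {b b' : ι → ℝ}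
    (h : signPattern b = signPattern b') : fusedGraph E b = fusedGraph E b' := by
  unfold fusedGraph
  simp only [eq_iff_of_signPattern_eq h]

lemma penaltySlope_eq_of_signPattern_eq (E : Finset (ι × ι)) (lF lL lNI : ℝ) {b b' : ι → ℝ}
    (h : signPattern b = signPattern b') (d : ι → ℝ) :
    penaltySlope E lF lL lNI b d = penaltySlope E lF lL lNI b' d := by
  have h1 : ∀ e : ι × ι, SignType.sign (b e.1 - b e.2) = SignType.sign (b' e.1 - b' e.2) :=
    congrFun (congrArg Prod.fst h)
  have h2 : ∀ i, SignType.sign (b i) = SignType.sign (b' i) := congrFun (congrArg Prod.snd h)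
  simp only [penaltySlope, h1, h2]

lemma eq_of_reachable {ι : Type*} {E : Finset (ι × ι)} {b : ι → ℝ} {i j : ι}
    (h : (fusedGraph E b).Reachable i j) : b i = b j := by
  obtain ⟨w⟩ := h
  induction w with
  | nil => rfl
  | cons hadj _ ih =>
    rw [← ih]
    simp only [fusedGraph, SimpleGraph.fromRel_adj] at hadj
    rcases hadj.2 with h | h
    · exact h.2
    · exact h.2.symm

open scoped Classical in
/-- The vertices of the fused group of `i`. -/
noncomputable def groupOf (E : Finset (ι × ι)) (b : ι → ℝ) (i : ι) : Finset ι :=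
  Finset.univ.filter fun j => (fusedGraph E b).Reachable i j

lemma mem_groupOf {E : Finset (ι × ι)} {b : ι → ℝ} {i j : ι} :
    j ∈ groupOf E b i ↔ (fusedGraph E b).Reachable i j := by
  simp [groupOf]

lemma groupOf_card_ne_zero (E : Finset (ι × ι)) (b : ι → ℝ) (i : ι) :
    ((groupOf E b i).card : ℝ) ≠ 0 := by
  have : i ∈ groupOf E b i := mem_groupOf.2 (SimpleGraph.Reachable.refl i)
  exact_mod_cast (Finset.card_pos.2 ⟨i, this⟩).ne'

lemma groupOf_eq_of_signPattern_eq (E : Finset (ι × ι)) {b b' : ι → ℝ}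
    (h : signPattern b = signPattern b') (i : ι) : groupOf E b i = groupOf E b' i := by
  unfold groupOf
  rw [fusedGraph_eq_of_signPattern_eq E h]

/-- The sum of the fitted values over a fused group. If the lasso parameter is positive, the
group has to be non-zero. -/
lemma IsMinimizer.card_mul_eq {E : Finset (ι × ι)} {y : ι → ℝ} {lF lL lNI : ℝ} {b : ι → ℝ}
    (hb : IsMinimizer E y lF lL lNI b) {i : ι} (hi : lL = 0 ∨ b i ≠ 0) :
    (groupOf E b i).card * b i = ∑ j ∈ groupOf E b i, y j -
      penaltySlope E lF lL lNI b (Set.indicator (groupOf E b i) 1) := by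
  rw [← hb.sum_sub_mul_eq]
  · have h1 : ∑ j, (y j - b j) * Set.indicator (groupOf E b i) 1 j =
        ∑ j ∈ groupOf E b i, (y j - b i) := by
      classical
      rw [← Finset.sum_subset (Finset.subset_univ (groupOf E b i))]
      · refine Finset.sum_congr rfl fun j hj => ?_
        rw [Set.indicator_of_mem (by exact_mod_cast hj), eq_of_reachable (mem_groupOf.1 hj)]
        simp
      · intro j _ hj
        rw [Set.indicator_of_notMem (by exact_mod_cast hj), mul_zero]
    rw [h1, Finset.sum_sub_distrib]
    simp
  · intro e he hbe
    -- Loops in `E` give no adjacency in a simple graph and are handled apart.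
    by_cases h : e.1 = e.2
    · rw [h]
    have hadj : (fusedGraph E b).Adj e.1 e.2 := by
      simp only [fusedGraph, SimpleGraph.fromRel_adj]
      exact ⟨h, Or.inl ⟨he, hbe⟩⟩
    have : e.1 ∈ (groupOf E b i : Set ι) ↔ e.2 ∈ (groupOf E b i : Set ι) := by
      simp only [Finset.mem_coe, mem_groupOf]
      exact ⟨fun h => h.trans hadj.reachable, fun h => h.trans hadj.symm.reachable⟩
    by_cases h2 : e.2 ∈ (groupOf E b i : Set ι)
    · rw [Set.indicator_of_mem h2, Set.indicator_of_mem (this.2 h2)]; rfl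
    · rw [Set.indicator_of_notMem h2, Set.indicator_of_notMem (mt this.1 h2)]
  · refine hi.imp_right fun hi j hj => Set.indicator_of_notMem (fun hm => hi ?_) _
    rw [eq_of_reachable (mem_groupOf.1 (Finset.mem_coe.1 hm)), hj]

open scoped Classical in
/-- Averaging over the fused groups of `b`, followed, if `z` holds, by setting to zero the entries
that are zero in `b`. -/
noncomputable def groupAverage (E : Finset (ι × ι)) (z : Prop) (b : ι → ℝ) :
    (ι → ℝ) →L[ℝ] (ι → ℝ) :=
  ContinuousLinearMap.pi fun i =>
    (if z → b i ≠ 0 then ((groupOf E b i).card : ℝ)⁻¹ else 0) •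
      ∑ j ∈ groupOf E b i, ContinuousLinearMap.proj j

open scoped Classical in
lemma groupAverage_apply (E : Finset (ι × ι)) (z : Prop) (b x : ι → ℝ) (i : ι) :
    groupAverage E z b x i = (if z → b i ≠ 0 then ((groupOf E b i).card : ℝ)⁻¹ else 0) *
      ∑ j ∈ groupOf E b i, x j := by
  rw [groupAverage, ContinuousLinearMap.coe_pi']
  by_cases h : z → b i ≠ 0
  · simp only [if_pos h]
    simp
  · simp only [if_neg h]
    simp

lemma groupAverage_eq_of_signPattern_eq (E : Finset (ι × ι)) (z : Prop) {b b' : ι → ℝ}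
    (h : signPattern b = signPattern b') : groupAverage E z b = groupAverage E z b' := by
  classical
  ext x i
  rw [groupAverage_apply, groupAverage_apply, groupOf_eq_of_signPattern_eq E h]
  congr 1
  exact if_congr (imp_congr_right fun _ => not_congr (eq_zero_iff_of_signPattern_eq h i)) rfl rfl

/-- Equal sign patterns give equal groups and equal penalty slopes, so the slopes cancel on
subtracting the two group equations. Discarded entries vanish in both minimisers. -/
lemma sub_eq_groupAverage_sub {E : Finset (ι × ι)} {lF lL lNI : ℝ} {z : Prop} (hz : z ∨ lL = 0)
    {y y' b b' : ι → ℝ} (hb : IsMinimizer E y lF lL lNI b) (hb' : IsMinimizer E y' lF lL lNI b')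
    (h : signPattern b = signPattern b') : b - b' = groupAverage E z b (y - y') := by
  ext i
  have hg := (groupOf_eq_of_signPattern_eq E h i).symm
  rw [groupAverage_apply]
  split_ifs with hi
  · have hi' : lL = 0 ∨ b i ≠ 0 := hz.symm.imp_right hi
    have h1 := hb.card_mul_eq hi'
    have h2 := hb'.card_mul_eq (hi'.imp_right (mt (eq_zero_iff_of_signPattern_eq h i).2))
    rw [hg, ← penaltySlope_eq_of_signPattern_eq E lF lL lNI h] at h2
    have hc := groupOf_card_ne_zero E b i
    simp only [Pi.sub_apply, Finset.sum_sub_distrib]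
    field_simp
    linarith
  · push Not at hi
    simp [hi.2, (eq_zero_iff_of_signPattern_eq h i).1 hi.2]

/-! ### Trace of the group averaging and the divergence almost everywhere -/

/-- The number of fused groups of `b`, not counting those with value zero if `z` holds. -/
noncomputable def groupCount (E : Finset (ι × ι)) (z : Prop) (b : ι → ℝ) : ℕ :=
  Nat.card {c : FusedGroup E b // z → ∀ i ∈ c.supp, b i ≠ 0}

open scoped Classical in
-- The sum is the trace of the averaging: each diagonal entry is the reciprocal of the group size or
-- zero, so a counted group contributes 1 and a discarded one 0.
lemma sum_groupAverage_single (E : Finset (ι × ι)) (z : Prop) (b : ι → ℝ) :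
    ∑ i, groupAverage E z b (Pi.single i 1) i = groupCount E z b := by
  have h1 : ∀ i, groupAverage E z b (Pi.single i 1) i =
      if z → b i ≠ 0 then ((groupOf E b i).card : ℝ)⁻¹ else 0 := fun i => by
    have hi : i ∈ groupOf E b i := mem_groupOf.2 (SimpleGraph.Reachable.refl i)
    rw [groupAverage_apply, Finset.sum_eq_single_of_mem i hi fun j _ hj => Pi.single_eq_of_ne hj _,
      Pi.single_eq_same, mul_one]
  simp only [h1]
  rw [← Finset.sum_fiberwise_of_maps_to (t := (Finset.univ : Finset (FusedGroup E b)))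
    (g := (fusedGraph E b).connectedComponentMk) (fun i _ => Finset.mem_univ _)]
  rw [groupCount, Nat.card_eq_fintype_card, Fintype.card_subtype, Finset.card_filter,
    Nat.cast_sum]
  refine Finset.sum_congr rfl fun c _ => ?_
  induction c using SimpleGraph.ConnectedComponent.ind with | _ v => ?_
  have hfib : (Finset.univ.filter fun i => (fusedGraph E b).connectedComponentMk i =
      (fusedGraph E b).connectedComponentMk v) = groupOf E b v := by
    ext j
    simp only [Finset.mem_filter, Finset.mem_univ, true_and, mem_groupOf,
      SimpleGraph.ConnectedComponent.eq]
    exact ⟨fun h => h.symm, fun h => h.symm⟩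
  have hsame : ∀ j ∈ groupOf E b v, groupOf E b j = groupOf E b v := fun j hj => by
    ext k
    simp only [mem_groupOf] at hj ⊢
    exact ⟨fun h => hj.trans h, fun h => hj.symm.trans h⟩
  have hcond : (z → ∀ i ∈ ((fusedGraph E b).connectedComponentMk v).supp, b i ≠ 0) ↔
      (z → b v ≠ 0) := by
    refine imp_congr_right fun _ => ⟨fun h => h v rfl, fun h i hi => ?_⟩
    rw [SimpleGraph.ConnectedComponent.mem_supp_iff, SimpleGraph.ConnectedComponent.eq] at hi
    rwa [eq_of_reachable hi]
  rw [hfib, Finset.sum_congr rfl fun j hj => by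
    rw [hsame j hj, ← eq_of_reachable (mem_groupOf.1 hj)]]
  simp only [hcond]
  have hc := groupOf_card_ne_zero E b v
  split_ifs <;> simp [hc]

lemma measurableSet_signPattern_eq {f : (ι → ℝ) → ι → ℝ} (hf : Measurable f)
    (s : (ι × ι → SignType) × (ι → SignType)) : MeasurableSet {y | signPattern (f y) = s} := by
  have hsign : ∀ {g : (ι → ℝ) → ℝ} (r : SignType), Measurable g →
      MeasurableSet {y | SignType.sign (g y) = r} := fun {g} r hg => by
    rcases r with _ | _ | _
    · simpa [sign_eq_zero_iff] using measurableSet_eq_fun hg (measurable_const (a := (0 : ℝ)))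
    · simpa [sign_eq_neg_one_iff] using measurableSet_lt hg (measurable_const (a := (0 : ℝ)))
    · simpa [sign_eq_one_iff] using measurableSet_lt (measurable_const (a := (0 : ℝ))) hg
  have : {y | signPattern (f y) = s} =
      (⋂ e : ι × ι, {y | SignType.sign (f y e.1 - f y e.2) = s.1 e}) ∩
        ⋂ i, {y | SignType.sign (f y i) = s.2 i} := by
    ext y
    simp [signPattern, Prod.ext_iff, funext_iff]
  rw [this]
  exact (MeasurableSet.iInter fun e => hsign _ (by fun_prop)).inter
    (MeasurableSet.iInter fun i => hsign _ (by fun_prop))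

/-- Almost everywhere, the divergence of the approximator is its number of fused groups. -/
lemma ae_sum_lineDeriv_eq_groupCount [DecidableEq ι] (E : Finset (ι × ι)) {lF lL lNI : ℝ}
    (hF : 0 ≤ lF) (hL : 0 ≤ lL) (hNI : 0 ≤ lNI) {z : Prop} (hz : z ∨ lL = 0) :
    ∀ᵐ y : ι → ℝ, ∑ i, lineDeriv ℝ (fun y => flni E y lF lL lNI i) y (Pi.single i 1) =
      groupCount E z (flni E y lF lL lNI) := by
  set f : (ι → ℝ) → ι → ℝ := fun y => flni E y lF lL lNI
  have hlip : LipschitzWith _ f := flni_lipschitz E hF hL hNI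
  have hdiff : ∀ᵐ y : ι → ℝ, DifferentiableAt ℝ f y := hlip.ae_differentiableAt
  have hmin : ∀ y, IsMinimizer E y lF lL lNI (f y) := fun y => flni_isMinimizer E y hF hL hNI
  -- There are finitely many patterns, so the exceptional null sets can be united at the end.
  have hpat : ∀ s, ∀ᵐ y : ι → ℝ, signPattern (f y) = s → DifferentiableAt ℝ f y →
      fderiv ℝ f y = groupAverage E z (f y) := by
    intro s
    rcases Set.eq_empty_or_nonempty {y | signPattern (f y) = s} with hs | ⟨y₀, hy₀⟩
    · exact ae_of_all _ fun y hy => absurd hy (Set.eq_empty_iff_forall_notMem.1 hs y)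
    set S := {y | signPattern (f y) = s} ∩ {y | DifferentiableAt ℝ f y}
    have hS : MeasurableSet S :=
      (measurableSet_signPattern_eq hlip.continuous.measurable s).inter
        (measurableSet_of_differentiableAt ℝ f)
    -- The error constant is 0 because `f` is exactly affine on `S`. By `norm_fderiv_sub_le` the
    -- derivative then equals the linear part at almost every point of `S`, which need not be open.
    have hlin : ApproximatesLinearOn f (groupAverage E z (f y₀)) S 0 := fun y hy y' hy' => by
      rw [sub_eq_groupAverage_sub hz (hmin y) (hmin y') (hy.1.trans hy'.1.symm),
        groupAverage_eq_of_signPattern_eq E z (hy.1.trans hy₀.symm)]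
      simp
    have hae := hlin.norm_fderiv_sub_le volume hS (fderiv ℝ f)
      fun y hy => (show DifferentiableAt ℝ f y from hy.2).hasFDerivAt.hasFDerivWithinAt
    rw [ae_restrict_iff' hS] at hae
    filter_upwards [hae] with y hy hys hyd
    rw [groupAverage_eq_of_signPattern_eq E z (hys.trans hy₀.symm)]
    simpa [sub_eq_zero] using hy ⟨hys, hyd⟩
  filter_upwards [hdiff, ae_all_iff.2 hpat] with y hy hy'
  rw [← sum_groupAverage_single, ← hy' _ rfl hy]
  refine Finset.sum_congr rfl fun i _ => ?_
  have h := ((hasFDerivAt_pi'.1 hy.hasFDerivAt i).hasLineDerivAt (Pi.single i 1)).lineDeriv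
  rw [h]
  simp only [ContinuousLinearMap.comp_apply, ContinuousLinearMap.proj_apply]
  congr!

/-! ### Degrees of freedom -/

/-- The shift by `β` drops out of the second argument, and since the noise is centred the covariance
is the integral in Stein's identity. -/
lemma covariance_eq_mul_integral_lineDeriv [DecidableEq ι] {v : ℝ≥0} (hv : v ≠ 0) (β : ι → ℝ)
    {C : ℝ≥0} {g : (ι → ℝ) → ℝ} (hg : LipschitzWith C g) (i : ι) :
    cov[fun x => g (β + x), fun x => (β + x) i; Measure.pi fun _ : ι => gaussianReal 0 v] =
      v * ∫ x, lineDeriv ℝ g (β + x) (Pi.single i 1)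
        ∂(Measure.pi fun _ : ι => gaussianReal 0 v) := by
  set μ := Measure.pi fun _ : ι => gaussianReal 0 v
  have hg' : LipschitzWith C fun x => g (β + x) := fun x y => by simpa using hg (β + x) (β + y)
  have hXi : MemLp (fun x : ι → ℝ => x i) 2 μ := (memLp_id_pi_gaussianReal v).eval i
  have hmean : ∫ x, x i ∂μ = 0 := by
    have hmp := measurePreserving_eval (fun _ : ι => gaussianReal 0 v) i
    have := integral_map (μ := μ) hmp.measurable.aemeasurable (f := fun t : ℝ => t)
      aestronglyMeasurable_id
    rw [hmp.map_eq, integral_id_gaussianReal] at this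
    exact this.symm
  have hline : ∀ x, lineDeriv ℝ (fun x => g (β + x)) x (Pi.single i 1) =
      lineDeriv ℝ g (β + x) (Pi.single i 1) := fun x => by
    simp only [lineDeriv, add_assoc]
  simp only [Pi.add_apply]
  rw [covariance_const_add_right (hXi.integrable (by norm_num)),
    covariance_eq_sub (hg'.memLp_comp (memLp_id_pi_gaussianReal v)) hXi, hmean, mul_zero, sub_zero]
  simp only [← hline]
  rw [← integral_mul_lipschitz_pi_gaussianReal hv hg' i]
  exact integral_congr_ae (ae_of_all _ fun x => mul_comm _ _)

/-- The degrees of freedom of the approximator are the expected number of fused groups, where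
groups with value zero are not counted if `z` holds. -/
lemma integral_groupCount_eq_degreesOfFreedom (E : Finset (ι × ι)) {lF lL lNI : ℝ}
    (hF : 0 ≤ lF) (hL : 0 ≤ lL) (hNI : 0 ≤ lNI) {z : Prop} (hz : z ∨ lL = 0)
    {Ω : Type*} [MeasurableSpace Ω] (P : Measure Ω) [IsProbabilityMeasure P]
    {σ : ℝ} (hσ : 0 < σ) (β : ι → ℝ) {ε Y : Ω → ι → ℝ}
    (hε : HasLaw ε (Measure.pi fun _ : ι => gaussianReal 0 (Real.toNNReal (σ ^ 2))) P)
    (hY : ∀ ω, Y ω = β + ε ω) :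
    (∀ i, MemLp (fun ω => flni E (Y ω) lF lL lNI i) 2 P) ∧
      Integrable (fun ω => (groupCount E z (flni E (Y ω) lF lL lNI) : ℝ)) P ∧
      ∫ ω, (groupCount E z (flni E (Y ω) lF lL lNI) : ℝ) ∂P =
        degreesOfFreedom P σ Y (fun y => flni E y lF lL lNI) := by
  classical
  obtain rfl : Y = fun ω => β + ε ω := funext hY
  set v := Real.toNNReal (σ ^ 2)
  have hv : v ≠ 0 := (Real.toNNReal_pos.2 (by positivity)).ne'
  have hvσ : (v : ℝ) = σ ^ 2 := Real.coe_toNNReal _ (by positivity)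
  set μ := Measure.pi fun _ : ι => gaussianReal 0 v
  have hlip := flni_lipschitz E hF hL hNI
  have hlipi : ∀ i, LipschitzWith _ fun y => flni E y lF lL lNI i := fun i =>
    LipschitzWith.of_dist_le_mul fun y y' =>
      (dist_le_pi_dist _ _ i).trans (hlip.dist_le_mul y y')
  have hshift : ∀ i, LipschitzWith _ fun x => flni E (β + x) lF lL lNI i := fun i =>
    LipschitzWith.of_dist_le_mul fun x y => by
      simpa only [dist_add_left] using (hlipi i).dist_le_mul (β + x) (β + y)
  -- Translation by `β` preserves Lebesgue null sets, and these are null for the Gaussian measure.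
  have hdiv : ∀ᵐ x ∂μ, ∑ i, lineDeriv ℝ (fun y => flni E y lF lL lNI i) (β + x)
      (Pi.single i 1) = groupCount E z (flni E (β + x) lF lL lNI) :=
    (pi_gaussianReal_absolutelyContinuous hv).ae_le
      ((measurePreserving_add_left volume β).quasiMeasurePreserving.ae
        (ae_sum_lineDeriv_eq_groupCount E hF hL hNI hz))
  have hline : ∀ i, Integrable (fun x => lineDeriv ℝ (fun y => flni E y lF lL lNI i) (β + x)
      (Pi.single i 1)) μ := fun i =>
    Integrable.of_bound ((measurable_lineDeriv (hlipi i).continuous).comp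
      (measurable_const_add β)).aestronglyMeasurable _
      (ae_of_all _ fun x => norm_lineDeriv_le_of_lipschitz ℝ (hlipi i))
  -- The count inherits measurability and integrability from the divergence, whose terms are bounded
  -- by the Lipschitz constants.
  have hcount : Integrable (fun x => (groupCount E z (flni E (β + x) lF lL lNI) : ℝ)) μ :=
    (integrable_finsetSum _ fun i _ => hline i).congr hdiv
  have hcount' : ∫ ω, (groupCount E z (flni E (β + ε ω) lF lL lNI) : ℝ) ∂P =
      ∫ x, (groupCount E z (flni E (β + x) lF lL lNI) : ℝ) ∂μ :=
    hε.integral_comp hcount.aestronglyMeasurable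
  refine ⟨fun i => ?_, ?_, ?_⟩
  · have h : MemLp _ 2 μ := (hshift i).memLp_comp (memLp_id_pi_gaussianReal v)
    rw [← hε.map_eq] at h
    exact h.comp_of_map hε.aemeasurable
  · rw [← hε.map_eq] at hcount
    exact hcount.comp_aemeasurable hε.aemeasurable
  · rw [hcount', ← integral_congr_ae hdiv, integral_finsetSum _ fun i _ => hline i,
      degreesOfFreedom]
    have hcov : ∀ i, cov[fun ω => flni E (β + ε ω) lF lL lNI i, fun ω => (β + ε ω) i; P] =
        σ ^ 2 * ∫ x, lineDeriv ℝ (fun y => flni E y lF lL lNI i) (β + x) (Pi.single i 1) ∂μ :=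
      fun i => by
        rw [← hvσ, ← covariance_eq_mul_integral_lineDeriv hv β (hlipi i) i]
        exact hε.covariance_fun_comp (f := fun x => flni E (β + x) lF lL lNI i)
          (g := fun x => (β + x) i) (hshift i).continuous.aemeasurable (by fun_prop)
    simp only [hcov, ← Finset.mul_sum]
    field_simp

end Estimator

/-! ### Specialisation to the two counts -/

lemma groupCount_false {ι : Type*} [Fintype ι] (E : Finset (ι × ι)) (b : ι → ℝ) :
    groupCount E False b = numFusedGroups E b :=
  Nat.card_congr (Equiv.subtypeUnivEquiv fun _ h => h.elim)

lemma groupCount_true {ι : Type*} [Fintype ι] (E : Finset (ι × ι)) (b : ι → ℝ) :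
    groupCount E True b = numNonzeroFusedGroups E b :=
  Nat.card_congr (Equiv.subtypeEquivRight fun _ => true_imp_iff)

end FusedNearlyIsotonic

theorem theorem3 {ι : Type*} [Fintype ι] (E : Finset (ι × ι))
    (lF lL lNI : ℝ) (hF : 0 ≤ lF) (hL : 0 ≤ lL) (hNI : 0 ≤ lNI)
    {Ω : Type*} [MeasurableSpace Ω] (P : Measure Ω) [IsProbabilityMeasure P]
    (σ : ℝ) (hσ : 0 < σ) (β : ι → ℝ) (ε Y : Ω → ι → ℝ)
    (hε : HasLaw ε (Measure.pi fun _ : ι => gaussianReal 0 (Real.toNNReal (σ ^ 2))) P)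
    (hY : ∀ ω, Y ω = β + ε ω) :
    ((∀ i, MemLp (fun ω => fni E (Y ω) lF lNI i) 2 P) ∧
      Integrable (fun ω => (numFusedGroups E (fni E (Y ω) lF lNI) : ℝ)) P ∧
      ∫ ω, (numFusedGroups E (fni E (Y ω) lF lNI) : ℝ) ∂P =
        degreesOfFreedom P σ Y (fun y => fni E y lF lNI)) ∧
    ((∀ i, MemLp (fun ω => flni E (Y ω) lF lL lNI i) 2 P) ∧
      Integrable (fun ω => (numNonzeroFusedGroups E (flni E (Y ω) lF lL lNI) : ℝ)) P ∧
      ∫ ω, (numNonzeroFusedGroups E (flni E (Y ω) lF lL lNI) : ℝ) ∂P =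
        degreesOfFreedom P σ Y (fun y => flni E y lF lL lNI)) := by
  constructor
  · have h := integral_groupCount_eq_degreesOfFreedom E hF le_rfl hNI (z := False) (Or.inr rfl) P
      hσ β hε hY
    simp only [groupCount_false] at h
    exact h
  · have h := integral_groupCount_eq_degreesOfFreedom E hF hL hNI (z := True) (Or.inl trivial) P
      hσ β hε hY
    simp only [groupCount_true] at h
    exact h
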